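/- Let $\mathbb D$ be the open unit disc. A semigroup of holomorphic self-maps of $\mathbb D$ is a family $(\varphi_t)_{t\ge 0}$ of holomorphic maps $\varphi_t:\mathbb D\to\mathbb D$ with $\varphi_0=\mathrm{id}$ and $\varphi_{s+t}=\varphi_s\circ\varphi_t$, continuous in $t$ for uniform convergence on compact subsets of $\mathbb D$; its infinitesimal generator is the holomorphic function $G:\mathbb D\to\mathbb C$ with $\frac{\partial}{\partial t}\varphi_t(z)=G(\varphi_t(z))$ for all $z\in\mathbb D$, $t\ge 0$. A point $x\in\partial\mathbb D$ is a regular pole of $G$ of mass $C>0$ if $$\angle\liminf_{z\to x}|G(z)(x-z)|=C,$$ where $\angle\liminf$ is the non-tangential lower limit, i.e. the infimum over $R>1$ of the lower limits as $z\to x$ in the Stolz angles $\{z\in\mathbb D:|x-z|<R(1-|z|)\}$. **Proposition 3.5 (Cowen–Pommerenke-type inequality).** Let $G$ be the infinitesimal generator of a semigroup of holomorphic self-maps of $\mathbb D$, given by the Berkson–Porta formula $G(z)=(\tau-z)(1-\overline{\tau}z)p(z)$, $z\in\mathbb D$, for some $\tau\in\overline{\mathbb D}$ and some holomorphic $p:\mathbb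 D\to\mathbb C$ with $\operatorname{Re}p(z)\ge 0$ for all $z\in\mathbb D$. Let $m\ge 0$, let $A_1,\dots,A_m>0$, and let $x_1,\dots,x_m\in\partial\mathbb D$ be pairwise distinct points such that $x_j$ is a regular pole of $G$ of mass $A_j$ for $j=1,\dots,m$. Then $x_j\ne\tau$ for every $j$, and $$\sum_{j=1}^m\frac{A_j}{2|x_j-\tau|^2}\le\operatorname{Re}p(0).$$ -/

import Mathlib

open Filter Topology Set Metric
open scoped ComplexConjugate ENNReal

/-- A (one-parameter, continuous) semigroup of holomorphic self-maps of the unit disc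
`ball 0 1`: a family `φ t`, `t ≥ 0`, of holomorphic self-maps of the disc with `φ 0 = id` and
`φ (s + t) = φ s ∘ φ t`, continuous in `t ∈ [0, ∞)` for uniform convergence on compact subsets
of the disc. The values of `φ` at negative times or outside the disc play no role. -/
structure IsHolomorphicSemigroup (φ : ℝ → ℂ → ℂ) : Prop where
  differentiableOn : ∀ t, 0 ≤ t → DifferentiableOn ℂ (φ t) (ball 0 1)
  mapsTo : ∀ t, 0 ≤ t → MapsTo (φ t) (ball 0 1) (ball 0 1)
  map_zero : ∀ z ∈ ball (0 : ℂ) 1, φ 0 z = z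
  map_add : ∀ s t, 0 ≤ s → 0 ≤ t → ∀ z ∈ ball (0 : ℂ) 1, φ (s + t) z = φ s (φ t z)
  continuous : ∀ t, 0 ≤ t → TendstoLocallyUniformlyOn φ (φ t) (𝓝[Ici 0] t) (ball 0 1)

/-- `G` is the infinitesimal generator of a semigroup `φ` of holomorphic self-maps of the unit
disc: `G` is holomorphic in the disc and `∂ φ_t(z) / ∂t = G(φ_t(z))` for `t ≥ 0`
(the derivative at `t = 0` is one-sided). -/
def IsInfinitesimalGenerator (G : ℂ → ℂ) : Prop :=
  DifferentiableOn ℂ G (ball 0 1) ∧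
    ∃ φ : ℝ → ℂ → ℂ, IsHolomorphicSemigroup φ ∧
      ∀ z ∈ ball (0 : ℂ) 1, ∀ t, 0 ≤ t →
        HasDerivWithinAt (fun s => φ s z) (G (φ t z)) (Ici 0) t

/-- The Stolz angle `{z ∈ 𝔻 : |x - z| < R (1 - |z|)}` of amplitude `R` at `x`. -/
def stolzAngle (x : ℂ) (R : ℝ) : Set ℂ :=
  {z | z ∈ ball (0 : ℂ) 1 ∧ ‖x - z‖ < R * (1 - ‖z‖)}

/-- The filter of non-tangential approach `z → x` to a point `x` of the unit circle: a property
holds eventually if and only if, for each `R > 1`, it holds for all `z` close to `x` in the Stolz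
angle of amplitude `R`. Limits along this filter are the angular limits. -/
noncomputable def nontangential (x : ℂ) : Filter ℂ :=
  ⨆ R : {R : ℝ // 1 < R}, 𝓝[stolzAngle x R] x

/-- `x` is a regular pole of `G` of mass `C`: `|x| = 1`, `C > 0`, and the angular lower limit of
`|G(z) (x - z)|` as `z → x`, computed in `[0, ∞]`, equals `C`. -/
def IsRegularPole (G : ℂ → ℂ) (x : ℂ) (C : ℝ) : Prop :=
  ‖x‖ = 1 ∧ 0 < C ∧
    liminf (fun z => ENNReal.ofReal ‖G z * (x - z)‖) (nontangential x) = ENNReal.ofReal C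

/-! On a radius, $|G(rx)(x-rx)|$ is $(1-r)|p(rx)|$ times a factor tending to $|x-\tau|^2$, so it
suffices that the sum of $(1-r)|p(rx_j)|$ is at most $2\operatorname{Re}p(0)+o(1)$ as $r\to1$. By
the Schwarz formula, $p(w)+\overline{p(0)}$ averages $z/(z-w)$ against $2\operatorname{Re}p\ge0$, of
total mass $2\operatorname{Re}p(0)$ (`sum_norm_add_conj_le`). A point $z$ can be near only one
$rx_j$, so the kernels sum to $1/(1-r)+O(1)$ (`sum_cauchy_kernel_le`). -/

/-- The Schwarz integral formula, with Cauchy's kernel. -/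
lemma circleAverage_cauchy_re {p : ℂ → ℂ} {R : ℝ} (hR : 0 < R)
    (hp : DiffContOnCl ℂ p (ball 0 R)) {w : ℂ} (hw : ‖w‖ < R) :
    Real.circleAverage (fun z => z / (z - w) * (2 * (p z).re : ℝ)) 0 R = p w + conj (p 0) := by
  have hcont : ContinuousOn p (sphere 0 |R|) := by
    rw [abs_of_pos hR]
    exact hp.continuousOn_ball.mono sphere_subset_closedBall
  have hne : ∀ z ∈ sphere (0 : ℂ) |R|, z - w ≠ 0 := by
    intro z hz h
    rw [abs_of_pos hR, mem_sphere_zero_iff_norm] at hz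
    rw [sub_eq_zero.1 h] at hz
    exact hw.ne hz
  have hker : ContinuousOn (fun z : ℂ => z / (z - w)) (sphere 0 |R|) :=
    ContinuousOn.div (by fun_prop) (by fun_prop) hne
  have hden : ∀ z ∈ closedBall (0 : ℂ) R, (R : ℂ) ^ 2 - conj w * z ≠ 0 := by
    intro z hz h
    rw [mem_closedBall_zero_iff] at hz
    have h1 : ‖(R : ℂ) ^ 2‖ = ‖conj w * z‖ := by rw [sub_eq_zero.1 h]
    rw [norm_pow, Complex.norm_real, Real.norm_of_nonneg hR.le, norm_mul, RCLike.norm_conj] at h1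
    nlinarith [norm_nonneg w, norm_nonneg z]
  have h1 : Real.circleAverage (fun z => z / (z - w) * p z) 0 R = p w := by
    have := DiffContOnCl.circleAverage_smul_div (f := p) (c := 0) (R := R) (w := w)
      (by rwa [abs_of_pos hR]) (by simpa [abs_of_pos hR] using hw)
    simpa using this
  -- The reflected kernel is holomorphic on the closed disc, equals 1 at 0, and on the circle is the
  -- conjugate of $z/(z-w)$.
  have h2 : Real.circleAverage (fun z => (R : ℂ) ^ 2 / (R ^ 2 - conj w * z) * p z) 0 R = p 0 := by
    have hd : DiffContOnCl ℂ (fun z => (R : ℂ) ^ 2 / (R ^ 2 - conj w * z) * p z)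
        (ball 0 |R|) := by
      rw [abs_of_pos hR]
      have hk : DifferentiableOn ℂ (fun z : ℂ => (R : ℂ) ^ 2 / (R ^ 2 - conj w * z))
          (closedBall 0 R) := by
        refine DifferentiableOn.div (by fun_prop) (by fun_prop) hden
      refine DiffContOnCl.smul (𝕜' := ℂ) ?_ hp
      refine DifferentiableOn.diffContOnCl ?_
      rwa [closure_ball _ hR.ne']
    rw [hd.circleAverage]
    have : (R : ℂ) ^ 2 ≠ 0 := by simp [hR.ne']
    simp [div_self this]
  have hint2 : ContinuousOn (fun z => (R : ℂ) ^ 2 / (R ^ 2 - conj w * z) * p z)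
      (sphere 0 |R|) := by
    refine ContinuousOn.mul (ContinuousOn.div (by fun_prop) (by fun_prop) ?_) hcont
    intro z hz
    rw [abs_of_pos hR] at hz
    exact hden z (sphere_subset_closedBall hz)
  have h3 : Real.circleAverage (fun z => z / (z - w) * conj (p z)) 0 R = conj (p 0) := by
    have := (Complex.conjCLE : ℂ →L[ℝ] ℂ).circleAverage_comp_comm hint2.circleIntegrable'
    rw [h2] at this
    simp only [ContinuousLinearEquiv.coe_coe, Complex.conjCLE_apply] at this
    rw [← this]
    refine Real.circleAverage_congr_sphere fun z hz => ?_
    have hz' := hne z hz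
    rw [abs_of_pos hR, mem_sphere_zero_iff_norm] at hz
    have hz0 : z ≠ 0 := by
      rintro rfl
      simp at hz
      exact hR.ne hz
    have hzz : (R : ℂ) ^ 2 = z * conj z := by rw [Complex.mul_conj', hz]
    have : conj z ≠ 0 := by simpa using hz0
    simp only [Function.comp_apply, Complex.conjCLE_apply,
      map_mul, map_div₀, map_sub, map_pow, Complex.conj_ofReal, Complex.conj_conj]
    congr 1
    rw [hzz, ← sub_mul, mul_div_mul_right _ _ this]
  have e : (fun z => z / (z - w) * ((2 * (p z).re : ℝ) : ℂ)) =
      fun z => z / (z - w) * p z + z / (z - w) * conj (p z) := by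
    funext z
    rw [← Complex.add_conj, mul_add]
  have hi : CircleIntegrable (fun z => z / (z - w) * p z) 0 R :=
    (hker.mul hcont).circleIntegrable'
  have hi' : CircleIntegrable (fun z => z / (z - w) * conj (p z)) 0 R :=
    (hker.mul (Complex.continuous_conj.comp_continuousOn hcont)).circleIntegrable'
  rw [e, Real.circleAverage_fun_add hi hi', h1, h3]

lemma norm_circleAverage_le {E : Type*} [NormedAddCommGroup E] [NormedSpace ℝ E]
    (f : ℂ → E) (c : ℂ) (R : ℝ) :
    ‖Real.circleAverage f c R‖ ≤ Real.circleAverage (fun z => ‖f z‖) c R := by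
  rw [Real.circleAverage, Real.circleAverage, norm_smul, smul_eq_mul,
    Real.norm_of_nonneg (by positivity)]
  gcongr
  exact intervalIntegral.norm_integral_le_integral_norm Real.two_pi_pos.le

/-- The kernels are summed under the average before being bounded, so the mass
$2\operatorname{Re}p(0)$ is counted once rather than once per point. -/
lemma sum_norm_add_conj_le {ι : Type*} [Fintype ι] {p : ℂ → ℂ} {R : ℝ} (hR : 0 < R)
    (hp : DiffContOnCl ℂ p (ball 0 R)) (hre : ∀ z ∈ sphere (0 : ℂ) R, 0 ≤ (p z).re)
    {w : ι → ℂ} (hw : ∀ j, ‖w j‖ < R) {K : ℝ}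
    (hK : ∀ z ∈ sphere (0 : ℂ) R, ∑ j, R / ‖z - w j‖ ≤ K) :
    ∑ j, ‖p (w j) + conj (p 0)‖ ≤ K * (2 * (p 0).re) := by
  have hcont : ContinuousOn p (sphere 0 |R|) := by
    rw [abs_of_pos hR]
    exact hp.continuousOn_ball.mono sphere_subset_closedBall
  have hreint : ContinuousOn (fun z => 2 * (p z).re) (sphere 0 |R|) :=
    (Complex.continuous_re.comp_continuousOn hcont).const_smul (2 : ℝ)
  have hne : ∀ j, ∀ z ∈ sphere (0 : ℂ) |R|, z - w j ≠ 0 := by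
    intro j z hz h
    rw [abs_of_pos hR, mem_sphere_zero_iff_norm] at hz
    rw [sub_eq_zero.1 h] at hz
    exact (hw j).ne hz
  have hint : ∀ j, CircleIntegrable
      (fun z => ‖z / (z - w j) * ((2 * (p z).re : ℝ) : ℂ)‖) 0 R := by
    intro j
    refine ContinuousOn.circleIntegrable' (ContinuousOn.norm (ContinuousOn.mul
      (ContinuousOn.div (by fun_prop) (by fun_prop) (hne j)) ?_))
    exact Complex.continuous_ofReal.comp_continuousOn hreint
  have hmean : Real.circleAverage (fun z => 2 * (p z).re) 0 R = 2 * (p 0).re := by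
    have h := Complex.reCLM.circleAverage_comp_comm hcont.circleIntegrable'
    rw [DiffContOnCl.circleAverage (by rwa [abs_of_pos hR])] at h
    have h' := Real.circleAverage_fun_smul (a := (2 : ℝ)) (f := fun z => (p z).re) (c := 0) (R := R)
    simp only [smul_eq_mul] at h'
    rw [h']
    congr 1
  calc ∑ j, ‖p (w j) + conj (p 0)‖
      ≤ ∑ j, Real.circleAverage (fun z => ‖z / (z - w j) * ((2 * (p z).re : ℝ) : ℂ)‖) 0 R := by
        refine Finset.sum_le_sum fun j _ => ?_
        rw [← circleAverage_cauchy_re hR hp (hw j)]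
        exact norm_circleAverage_le _ _ _
    _ = Real.circleAverage
          (fun z => ∑ j, ‖z / (z - w j) * ((2 * (p z).re : ℝ) : ℂ)‖) 0 R :=
        (Real.circleAverage_fun_sum fun j _ => hint j).symm
    _ ≤ Real.circleAverage (fun z => K * (2 * (p z).re)) 0 R := by
        refine Real.circleAverage_mono (CircleIntegrable.fun_sum _ fun j _ => hint j)
          (hreint.const_smul K).circleIntegrable' fun z hz => ?_
        rw [abs_of_pos hR] at hz
        have h0 := hre z hz
        have := mul_le_mul_of_nonneg_right (hK z hz) (by positivity : 0 ≤ 2 * (p z).re)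
        refine le_of_eq_of_le ?_ this
        rw [Finset.sum_mul]
        refine Finset.sum_congr rfl fun j _ => ?_
        rw [norm_mul, norm_div, Complex.norm_real, Real.norm_of_nonneg (by positivity),
          mem_sphere_zero_iff_norm.1 hz]
    _ = K * (2 * (p 0).re) := by
        rw [← hmean, ← smul_eq_mul, ← Real.circleAverage_fun_smul]
        rfl

/-! ### Radial growth at several boundary points -/

lemma sum_cauchy_kernel_le {ι : Type*} [Fintype ι] {x : ι → ℂ} (hx : ∀ j, ‖x j‖ = 1) {d : ℝ}
    (hd : 0 < d) (hsep : ∀ i j, i ≠ j → d ≤ ‖x i - x j‖) {r R : ℝ} (hr : 1 / 2 ≤ r) (hrR : r < R)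
    {z : ℂ} (hz : ‖z‖ = R) :
    ∑ j, R / ‖z - r * x j‖ ≤ R / (R - r) + Fintype.card ι * (R * 4 / d) := by
  classical
  have hR : 0 < R := by linarith
  have hlow : ∀ j, R - r ≤ ‖z - r * x j‖ := by
    intro j
    have := norm_sub_norm_le z (r * x j)
    rw [norm_mul, hx, hz, Complex.norm_real, Real.norm_of_nonneg (by linarith)] at this
    linarith
  have hfar : ∀ j, d / 4 ≤ ‖z - r * x j‖ → R / ‖z - r * x j‖ ≤ R * 4 / d := by
    intro j hj
    calc R / ‖z - r * x j‖ ≤ R / (d / 4) := by gcongr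
      _ = R * 4 / d := by field_simp
  have hRr : 0 < R - r := by linarith
  have hc : ∑ _j : ι, R * 4 / d = Fintype.card ι * (R * 4 / d) := by simp
  by_cases h : ∃ i, ‖z - r * x i‖ < d / 4
  · obtain ⟨i, hi⟩ := h
    have hs : ∑ j, (if j = i then R / (R - r) else 0) = R / (R - r) := by simp
    rw [← hc, ← hs, ← Finset.sum_add_distrib]
    refine Finset.sum_le_sum fun j _ => ?_
    split_ifs with hji
    · have : R / ‖z - r * x j‖ ≤ R / (R - r) := by
        gcongr
        exact hlow j
      have : 0 < R * 4 / d := by positivity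
      linarith
    · rw [zero_add]
      refine hfar j ?_
      -- Since $r\ge1/2$, the points $rx_j$ are at least $d/2$ apart, so at most one is within $d/4$
      -- of $z$.
      have h1 : ‖(r : ℂ) * x j - r * x i‖ ≤ ‖z - r * x i‖ + ‖z - r * x j‖ := by
        have := norm_sub_le (z - r * x i) (z - r * x j)
        rwa [sub_sub_sub_cancel_left] at this
      rw [← mul_sub, norm_mul, Complex.norm_real, Real.norm_of_nonneg (by linarith)] at h1
      have h2 := hsep j i hji
      nlinarith
  · push Not at h
    rw [← hc]
    have h1 : ∑ j, R / ‖z - r * x j‖ ≤ ∑ _j : ι, R * 4 / d :=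
      Finset.sum_le_sum fun j _ => hfar j (h j)
    have : 0 < R / (R - r) := by positivity
    linarith

lemma exists_separation {ι : Type*} [Finite ι] {x : ι → ℂ} (hx : Function.Injective x) :
    ∃ d : ℝ, 0 < d ∧ ∀ i j, i ≠ j → d ≤ ‖x i - x j‖ := by
  have h : ∀ᶠ d in 𝓝[>] (0 : ℝ), ∀ q : ι × ι, q.1 ≠ q.2 → d ≤ ‖x q.1 - x q.2‖ := by
    refine eventually_all.2 fun q => ?_
    by_cases hq : q.1 = q.2
    · simp [hq]
    · have : 0 < ‖x q.1 - x q.2‖ := norm_pos_iff.2 (sub_ne_zero.2 (hx.ne hq))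
      filter_upwards [nhdsWithin_le_nhds (Iic_mem_nhds this)] with d hd _ using hd
  obtain ⟨d, hd, h0⟩ := (h.and self_mem_nhdsWithin).exists
  exact ⟨d, h0, fun i j hij => hd (i, j) hij⟩

lemma ofReal_mul_mem_ball {x : ℂ} (hx : ‖x‖ = 1) {r : ℝ} (h0 : 0 ≤ r) (h1 : r < 1) :
    (r : ℂ) * x ∈ ball (0 : ℂ) 1 := by
  rw [mem_ball_zero_iff, norm_mul, hx, Complex.norm_real, Real.norm_of_nonneg h0, mul_one]
  exact h1

/-- The total radial growth of a function with nonnegative real part at finitely many boundary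
points. -/
lemma exists_tendsto_sum_radial_le {ι : Type*} [Fintype ι] {p : ℂ → ℂ}
    (hp : DifferentiableOn ℂ p (ball 0 1)) (hre : ∀ z ∈ ball (0 : ℂ) 1, 0 ≤ (p z).re)
    {x : ι → ℂ} (hx : ∀ j, ‖x j‖ = 1) (hinj : Function.Injective x) :
    ∃ B : ℝ → ℝ, Tendsto B (𝓝[<] 1) (𝓝 (2 * (p 0).re)) ∧
      ∀ᶠ r : ℝ in 𝓝[<] 1, ∑ j, (1 - r) * ‖p (r * x j)‖ ≤ B r := by
  obtain ⟨d, hd, hsep⟩ := exists_separation hinj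
  -- This is $1-r$ times the kernel bound at $R=1$, plus the cost of removing $\overline{p(0)}$ from
  -- each term.
  refine ⟨fun r => (1 + (1 - r) * (Fintype.card ι * (4 / d))) * (2 * (p 0).re)
    + (1 - r) * (Fintype.card ι * ‖p 0‖), ?_, ?_⟩
  · refine Tendsto.mono_left (Continuous.tendsto' (by fun_prop) _ _ (by simp)) nhdsWithin_le_nhds
  · filter_upwards [Ico_mem_nhdsLT (show (1 / 2 : ℝ) < 1 by norm_num)] with r ⟨hr, hr1⟩
    have hmain : ∑ j, ‖p (r * x j) + conj (p 0)‖ ≤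
        (1 / (1 - r) + Fintype.card ι * (1 * 4 / d)) * (2 * (p 0).re) := by
      -- Nothing is known about $p$ on the unit circle, so the estimate is made at $r<R<1$ and then
      -- $R\to1$.
      have hlim : Tendsto (fun R : ℝ => (R / (R - r) + Fintype.card ι * (R * 4 / d))
          * (2 * (p 0).re)) (𝓝[<] 1)
          (𝓝 ((1 / (1 - r) + Fintype.card ι * (1 * 4 / d)) * (2 * (p 0).re))) := by
        refine Tendsto.mono_left (ContinuousAt.tendsto ?_) nhdsWithin_le_nhds
        have : (1 : ℝ) - r ≠ 0 := by linarith
        fun_prop (disch := assumption)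
      refine ge_of_tendsto hlim ?_
      filter_upwards [Ioo_mem_nhdsLT hr1] with R ⟨hR, hR1⟩
      have hR0 : 0 < R := by linarith
      have hsub : closedBall (0 : ℂ) R ⊆ ball 0 1 := closedBall_subset_ball hR1
      refine sum_norm_add_conj_le hR0 ?_ (fun z hz => hre z (hsub (sphere_subset_closedBall hz)))
        (fun j => ?_) fun z hz =>
          sum_cauchy_kernel_le hx hd hsep hr hR (mem_sphere_zero_iff_norm.1 hz)
      · refine DifferentiableOn.diffContOnCl ?_
        rw [closure_ball _ hR0.ne']
        exact hp.mono hsub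
      · rw [norm_mul, hx, Complex.norm_real, Real.norm_of_nonneg (by linarith), mul_one]
        exact hR
    have hr1' : 0 < 1 - r := by linarith
    have htri : ∑ j, ‖p (r * x j)‖ ≤
        ∑ j, ‖p (r * x j) + conj (p 0)‖ + Fintype.card ι * ‖p 0‖ := by
      have hc : ∑ _j : ι, ‖p 0‖ = Fintype.card ι * ‖p 0‖ := by simp
      rw [← hc, ← Finset.sum_add_distrib]
      refine Finset.sum_le_sum fun j _ => ?_
      have := norm_sub_le (p (r * x j) + conj (p 0)) (conj (p 0))
      rwa [add_sub_cancel_right, RCLike.norm_conj] at this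
    rw [← Finset.mul_sum]
    calc (1 - r) * ∑ j, ‖p (r * x j)‖
        ≤ (1 - r) * ((1 / (1 - r) + Fintype.card ι * (1 * 4 / d)) * (2 * (p 0).re)
          + Fintype.card ι * ‖p 0‖) := by gcongr; linarith
      _ = _ := by field_simp

/-! ### From regular poles to radial limits -/

lemma tendsto_radial_nontangential {x : ℂ} (hx : ‖x‖ = 1) :
    Tendsto (fun r : ℝ => (r : ℂ) * x) (𝓝[<] 1) (nontangential x) := by
  -- The amplitude 2 is arbitrary: on the radius $|x-z|=1-|z|$.
  have h : 𝓝[stolzAngle x 2] x ≤ nontangential x :=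
    le_iSup (fun R : {R : ℝ // 1 < R} => 𝓝[stolzAngle x R] x) ⟨2, one_lt_two⟩
  refine Tendsto.mono_right (tendsto_nhdsWithin_iff.2 ⟨?_, ?_⟩) h
  · exact Tendsto.mono_left (Continuous.tendsto' (by fun_prop) _ _ (by simp)) nhdsWithin_le_nhds
  · filter_upwards [Ioo_mem_nhdsLT (zero_lt_one' ℝ)] with r ⟨h0, h1⟩
    refine ⟨ofReal_mul_mem_ball hx h0.le h1, ?_⟩
    have : x - r * x = ((1 - r : ℝ) : ℂ) * x := by push_cast; ring
    rw [this, norm_mul, norm_mul, hx, Complex.norm_real, Complex.norm_real,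
      Real.norm_of_nonneg h0.le, Real.norm_of_nonneg (by linarith)]
    linarith

lemma IsRegularPole.eventually_lt_radial {G : ℂ → ℂ} {x : ℂ} {A : ℝ} (h : IsRegularPole G x A)
    {a : ℝ} (ha : a < A) : ∀ᶠ r : ℝ in 𝓝[<] 1, a < ‖G (r * x) * (x - r * x)‖ := by
  obtain ⟨hx, hA, hlim⟩ := h
  have h1 : ENNReal.ofReal a <
      liminf (fun z => ENNReal.ofReal ‖G z * (x - z)‖) (nontangential x) := by
    rw [hlim]
    exact (ENNReal.ofReal_lt_ofReal_iff hA).2 ha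
  filter_upwards [(tendsto_radial_nontangential hx).eventually (eventually_lt_of_lt_liminf h1)]
    with r hr
  exact lt_of_not_ge fun hle => hr.not_ge (ENNReal.ofReal_le_ofReal hle)

/-- The modulus of the Berkson–Porta factor `(τ - z) (1 - conj τ z)` on the radius ending at a
boundary point `x` tends to `|x - τ| ^ 2`. -/
lemma tendsto_berksonPorta_factor {x : ℂ} (hx : ‖x‖ = 1) (τ : ℂ) :
    Tendsto (fun r : ℝ => ‖(τ - r * x) * (1 - conj τ * (r * x))‖) (𝓝[<] 1)
      (𝓝 (‖x - τ‖ ^ 2)) := by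
  refine Tendsto.mono_left (Continuous.tendsto' (by fun_prop) _ _ ?_) nhdsWithin_le_nhds
  have h1 : 1 - conj τ * x = conj (x - τ) * x := by
    rw [map_sub, sub_mul, mul_comm (conj x), Complex.mul_conj', hx]
    simp
  rw [Complex.ofReal_one, one_mul, h1, norm_mul, norm_mul, RCLike.norm_conj, hx, mul_one,
    norm_sub_rev τ x, sq]

theorem proposition3p5 (G p : ℂ → ℂ) (τ : ℂ) (hτ : ‖τ‖ ≤ 1)
    (hG : IsInfinitesimalGenerator G)
    (hp : DifferentiableOn ℂ p (ball 0 1))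
    (hp_re : ∀ z ∈ ball (0 : ℂ) 1, 0 ≤ (p z).re)
    (hBP : ∀ z ∈ ball (0 : ℂ) 1, G z = (τ - z) * (1 - conj τ * z) * p z)
    (m : ℕ) (x : Fin m → ℂ) (A : Fin m → ℝ)
    (hx_inj : Function.Injective x)
    (hx : ∀ j, IsRegularPole G (x j) (A j)) :
    (∀ j, x j ≠ τ) ∧ ∑ j, A j / (2 * ‖x j - τ‖ ^ 2) ≤ (p 0).re := by
  obtain ⟨B, hB, hsum⟩ := exists_tendsto_sum_radial_le hp hp_re (fun j => (hx j).1) hx_inj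
  have hlow : ∀ j, ∀ a < A j, ∀ᶠ r : ℝ in 𝓝[<] 1, a <
      ‖(τ - r * x j) * (1 - conj τ * (r * x j))‖ * ((1 - r) * ‖p (r * x j)‖) := by
    intro j a ha
    filter_upwards [(hx j).eventually_lt_radial ha, Ioo_mem_nhdsLT (zero_lt_one' ℝ)]
      with r hr ⟨h0, h1⟩
    rw [hBP _ (ofReal_mul_mem_ball (hx j).1 h0.le h1)] at hr
    have e : x j - r * x j = ((1 - r : ℝ) : ℂ) * x j := by push_cast; ring
    rw [e, norm_mul, norm_mul, norm_mul _ (x j), (hx j).1, Complex.norm_real,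
      Real.norm_of_nonneg (by linarith)] at hr
    linarith
  have hne : ∀ j, x j ≠ τ := by
    intro j hj
    have hA := (hx j).2.1
    -- If $x_j=\tau$ the factor tends to 0 while $(1-r)|p(rx_j)|$ stays bounded, against the lower
    -- bound $A_j/2$.
    have hk := (tendsto_berksonPorta_factor (hx j).1 τ).mul hB
    rw [hj, sub_self, norm_zero, zero_pow two_ne_zero, zero_mul] at hk
    have : A j / 2 ≤ 0 := by
      refine ge_of_tendsto hk ?_
      filter_upwards [hlow j (A j / 2) (by linarith), hsum, Ioo_mem_nhdsLT (zero_lt_one' ℝ)]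
        with r h1 h2 ⟨_, h3⟩
      rw [hj] at h1
      refine h1.le.trans (mul_le_mul_of_nonneg_left (le_trans ?_ h2) (norm_nonneg _))
      rw [← hj]
      exact Finset.single_le_sum (f := fun j => (1 - r) * ‖p (r * x j)‖)
        (fun i _ => mul_nonneg (by linarith) (norm_nonneg _)) (Finset.mem_univ j)
    linarith
  refine ⟨hne, ?_⟩
  have hpos : ∀ j, 0 < ‖x j - τ‖ ^ 2 := fun j =>
    pow_pos (norm_pos_iff.2 (sub_ne_zero.2 (hne j))) 2
  -- The lower limit only gives bounds by constants below $A_j$, hence the loss of ε.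
  have hstep : ∀ ε > 0, ∑ j, (A j - ε) / ‖x j - τ‖ ^ 2 ≤ 2 * (p 0).re := by
    intro ε hε
    have hl : Tendsto (fun r : ℝ =>
        ∑ j, (A j - ε) / ‖(τ - r * x j) * (1 - conj τ * (r * x j))‖) (𝓝[<] 1)
        (𝓝 (∑ j, (A j - ε) / ‖x j - τ‖ ^ 2)) :=
      tendsto_finsetSum _ fun j _ =>
        tendsto_const_nhds.div (tendsto_berksonPorta_factor (hx j).1 τ) (hpos j).ne'
    refine le_of_tendsto_of_tendsto hl hB ?_
    have h1 := eventually_all.2 fun j => hlow j (A j - ε) (by linarith)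
    have h2 := eventually_all.2 fun j =>
      (tendsto_berksonPorta_factor (hx j).1 τ).eventually_const_lt (hpos j)
    filter_upwards [h1, h2, hsum] with r h1 h2 h3
    refine le_trans (Finset.sum_le_sum fun j _ => ?_) h3
    rw [div_le_iff₀ (h2 j), mul_comm _ ‖_‖]
    exact (h1 j).le
  have hfin : ∑ j, A j / ‖x j - τ‖ ^ 2 ≤ 2 * (p 0).re := by
    have hl : Tendsto (fun ε : ℝ => ∑ j, (A j - ε) / ‖x j - τ‖ ^ 2) (𝓝[>] 0)
        (𝓝 (∑ j, A j / ‖x j - τ‖ ^ 2)) := by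
      refine Tendsto.mono_left (Continuous.tendsto' ?_ _ _ (by simp)) nhdsWithin_le_nhds
      fun_prop
    exact le_of_tendsto hl (eventually_nhdsWithin_of_forall hstep)
  have e : ∑ j, A j / (2 * ‖x j - τ‖ ^ 2) = (∑ j, A j / ‖x j - τ‖ ^ 2) / 2 := by
    rw [Finset.sum_div]
    refine Finset.sum_congr rfl fun j _ => ?_
    rw [div_div, mul_comm]
  rw [e]
  linarith
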